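/- Let $\boldsymbol{Y}=\boldsymbol{X}\boldsymbol{B}^*+\boldsymbol{E}$ with a fixed design $\boldsymbol{X}\in\mathbb R^{n\times p}$ ($n\ge 1$), $\boldsymbol{0}\neq\boldsymbol{B}^*\in\mathbb R^{p\times m}$, and a random matrix $\boldsymbol{E}\in\mathbb R^{n\times m}$ such that $\mathrm{vec}(\boldsymbol{E})$ is sub-Gaussian with mean $\boldsymbol 0$ and scale bounded by $\sigma\ge 0$. Here a real random variable $\xi$ is sub-Gaussian if $\mathbb P(|\xi|\ge t)\le Ce^{-ct^2}$ for all $t>0$ and some $C,c>0$, its scale is $\inf\{s>0:\mathbb E\exp(\xi^2/s^2)\le 2\}$, and a random vector $\boldsymbol\xi$ is sub-Gaussian with scale bounded by $\sigma$ if, for every $\boldsymbol\alpha$, $\langle\boldsymbol\xi,\boldsymbol\alpha\rangle$ is sub-Gaussian with scale at most $\sigma\|\boldsymbol\alpha\|_2$. For $\boldsymbol{B}=[\boldsymbol\beta_1,\dots,\boldsymbol\beta_p]^T\in\mathbb R^{p\times m}$ let $r(\boldsymbol{B})$ be its rank, $\mathcal J(\boldsymbol{B})=\{j:\boldsymbol\beta_j\neq\boldsymbol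 0\}$, $J(\boldsymbol{B})=|\mathcal J(\boldsymbol{B})|$, $\|\boldsymbol{B}\|_{2,\infty}=\max_{1\le j\le p}\|\boldsymbol\beta_j\|_2$, and, with $q=\operatorname{rank}(\boldsymbol{X})$, $$P_o(\boldsymbol{B})=[q\wedge J(\boldsymbol{B})+m-r(\boldsymbol{B})]\,r(\boldsymbol{B})+J(\boldsymbol{B})\log\frac{ep}{J(\boldsymbol{B})},\qquad P_o(\boldsymbol 0)=0,\qquad P(\boldsymbol{B};A)=A\sigma^2P_o(\boldsymbol{B}).$$ Write $\mathcal J^*=\mathcal J(\boldsymbol{B}^*)$, $J^*=J(\boldsymbol{B}^*)$, $r^*=r(\boldsymbol{B}^*)$. There are universal constants $A_0,C,c>0$ with the following property. Let $A\ge A_0$ and $\kappa>0$ be such that $$\tfrac12\,\kappa nJ^*\|\boldsymbol{B}-\boldsymbol{B}^*\|_{2,\infty}^2\le\tfrac12\|\boldsymbol{X}\boldsymbol{B}-\boldsymbol{X}\boldsymbol{B}^*\|_F^2+P(\boldsymbol{B};A)+P(\boldsymbol{B}^*;A)\qquad\text{for all }\boldsymbol{B}\in\mathbb R^{p\times m}.$$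 Then there is an event of probability at least $1-Cp^{-c}$ on which every global minimizer $\hat{\boldsymbol{B}}=[\hat{\boldsymbol\beta}_1,\dots,\hat{\boldsymbol\beta}_p]^T$ of $\boldsymbol{B}\mapsto\frac12\|\boldsymbol{Y}-\boldsymbol{X}\boldsymbol{B}\|_F^2+P(\boldsymbol{B};A)$ over $\mathbb R^{p\times m}$ satisfies $$\|\hat{\boldsymbol{B}}-\boldsymbol{B}^*\|_{2,\infty}^2\le 8A\sigma^2\,\frac{P_o(\boldsymbol{B}^*)}{\kappa nJ^*}\le 8A\sigma^2\Big\{\frac{r^*+\log p}{n\kappa}+\frac{mr^*}{nJ^*\kappa}\Big\},$$ and, if in addition $$\min_{j\in\mathcal J^*}\|\boldsymbol\beta^*_j\|_2\ge4\sqrt{2A}\,\sigma\Big\{\frac{r^*+\log p}{n\kappa}+\frac{mr^*}{nJ^*\kappa}\Big\}^{1/2},$$ then on that event also $\mathcal J^*\subset\mathcal J(\hat{\boldsymbol{B}})$, and the norms $\|\hat{\boldsymbol\beta}_j\|_2$, $j\in\mathcal J^*$, are exactly the $J^*$ largest among $\|\hat{\boldsymbol\beta}_1\|_2,\dots,\|\hat{\boldsymbol\beta}_p\|_2$,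 that is, $\|\hat{\boldsymbol\beta}_{j'}\|_2<\|\hat{\boldsymbol\beta}_j\|_2$ for all $j\in\mathcal J^*$ and $j'\notin\mathcal J^*$. -/

import Mathlib

open MeasureTheory
open scoped ENNReal Matrix

namespace PIC

noncomputable section

/-! ### Sub-Gaussian random variables and vectors -/

/-- A real random variable `Z` is sub-Gaussian if `ℙ(|Z| ≥ t) ≤ C exp (-c t²)` for every `t > 0`
and some constants `C, c > 0`. -/
def IsSubGaussian {Ω : Type*} [MeasurableSpace Ω] (P : Measure Ω) (Z : Ω → ℝ) : Prop :=
  ∃ C > 0, ∃ c > 0, ∀ t > 0, P.real {ω | t ≤ |Z ω|} ≤ C * Real.exp (-c * t ^ 2)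

/-- The scale `inf {s > 0 : 𝔼 exp (Z² / s²) ≤ 2}` of a sub-Gaussian random variable `Z`.
The expectation is taken in `[0, ∞]`. -/
def subGaussianScale {Ω : Type*} [MeasurableSpace Ω] (P : Measure Ω) (Z : Ω → ℝ) : ℝ :=
  sInf {s : ℝ | 0 < s ∧ ∫⁻ ω, ENNReal.ofReal (Real.exp (Z ω ^ 2 / s ^ 2)) ∂P ≤ 2}

/-- A random vector `ξ` is sub-Gaussian with scale bounded by `σ` if every `⟨ξ, α⟩` is sub-Gaussian
with scale at most `σ ‖α‖₂`. -/
def IsSubGaussianVector {Ω ι : Type*} [MeasurableSpace Ω] [Fintype ι] (P : Measure Ω)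
    (ξ : Ω → ι → ℝ) (σ : ℝ) : Prop :=
  ∀ α : ι → ℝ, IsSubGaussian P (fun ω => ξ ω ⬝ᵥ α) ∧
    subGaussianScale P (fun ω => ξ ω ⬝ᵥ α) ≤ σ * √(∑ i, α i ^ 2)

/-! ### Norms and row support of a matrix -/

/-- The squared Frobenius norm. -/
def frobSq {n m : ℕ} (M : Matrix (Fin n) (Fin m) ℝ) : ℝ :=
  ∑ i, ∑ k, M i k ^ 2

/-- The Euclidean norm of the `j`-th row. -/
def rowNorm {p m : ℕ} (B : Matrix (Fin p) (Fin m) ℝ) (j : Fin p) : ℝ :=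
  √(∑ k, B j k ^ 2)

/-- The norm `‖B‖_{2,∞}`: the largest Euclidean norm of a row. -/
def norm2Inf {p m : ℕ} (B : Matrix (Fin p) (Fin m) ℝ) : ℝ :=
  ⨆ j, rowNorm B j

open Classical in
/-- The row support: the set of indices of the nonzero rows. -/
def rowSupport {p m : ℕ} (B : Matrix (Fin p) (Fin m) ℝ) : Finset (Fin p) :=
  Finset.univ.filter fun j => rowNorm B j ≠ 0

/-! ### The predictive information criterion -/

/-- The complexity
`P_o(B) = [q ∧ J(B) + m - r(B)] r(B) + J(B) log (e p / J(B))`, where `q = rank X`, `r(B) = rank B`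
and `J(B)` is the number of nonzero rows of `B`. In particular `P_o(0) = 0`. -/
def complexity {n p m : ℕ} (X : Matrix (Fin n) (Fin p) ℝ) (B : Matrix (Fin p) (Fin m) ℝ) : ℝ :=
  (min (X.rank : ℝ) ((rowSupport B).card : ℝ) + (m : ℝ) - (B.rank : ℝ)) * (B.rank : ℝ) +
    ((rowSupport B).card : ℝ) * Real.log (Real.exp 1 * (p : ℝ) / ((rowSupport B).card : ℝ))

/-- The penalty `P(B; A) = A σ² P_o(B)`. -/
def penalty {n p m : ℕ} (X : Matrix (Fin n) (Fin p) ℝ) (σ A : ℝ)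
    (B : Matrix (Fin p) (Fin m) ℝ) : ℝ :=
  A * σ ^ 2 * complexity X B

/-- The criterion `½ ‖Y - X B‖_F² + P(B; A)`. -/
def criterion {n p m : ℕ} (X : Matrix (Fin n) (Fin p) ℝ) (Y : Matrix (Fin n) (Fin m) ℝ) (σ A : ℝ)
    (B : Matrix (Fin p) (Fin m) ℝ) : ℝ :=
  1 / 2 * frobSq (Y - X * B) + penalty X σ A B

/-- `Bhat` is a global minimizer of the criterion over all `p × m` matrices. -/
def IsPICMinimizer {n p m : ℕ} (X : Matrix (Fin n) (Fin p) ℝ) (Y : Matrix (Fin n) (Fin m) ℝ)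
    (σ A : ℝ) (Bhat : Matrix (Fin p) (Fin m) ℝ) : Prop :=
  ∀ B : Matrix (Fin p) (Fin m) ℝ, criterion X Y σ A Bhat ≤ criterion X Y σ A B

/-- The rate `(r + log p) / (n κ) + m r / (n J κ)` with `r = rank B`, `J = J(B)`. -/
def rowwiseRate {p m : ℕ} (n : ℕ) (κ : ℝ) (B : Matrix (Fin p) (Fin m) ℝ) : ℝ :=
  ((B.rank : ℝ) + Real.log (p : ℝ)) / ((n : ℝ) * κ) +
    (m : ℝ) * (B.rank : ℝ) / ((n : ℝ) * ((rowSupport B).card : ℝ) * κ)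

end

end PIC

/-! Comparing the criterion at a minimizer `Bhat` and at `Bstar` gives, with `Δ = Bhat - Bstar`, the
basic inequality ½‖XΔ‖² + P(Bhat) ≤ ⟨E, XΔ⟩ + P(Bstar). The theorem follows once, with high
probability, the noise term is at most ¼‖XΔ‖² + ¼P(Bhat) + ¼P(Bstar), simultaneously for all
candidates (`pairing_colVec_le`): the right side of the hypothesis on `κ` is then at most 7/2 ·
P(Bstar), which bounds the row-wise error.

The noise bound splits `XΔ` orthogonally along the column space of `X Bstar`. The part inside lies
in a fixed subspace. The part outside is a projection of `X Bhat`, so it depends on `Bstar` only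
through a fixed projection; its rank is at most that of `Bhat`, and its columns lie in a space
determined by the row support of `Bhat`.

For one such space S and one rank r, a family of columns factors as UV through ℝ^r, and nets for U
and V have together at most 5^((dim S + m) r) points (`measureReal_lowRank_pairing_le`). A
sub-Gaussian tail at each point and a union bound over ranks and supports cost (dim S + m) r + J
log(ep/J), up to constants. This is at most twice `complexity` (`add_mul_le_two_mul_degrees`), so a
large enough `A` lets the penalty absorb it. -/

namespace PIC

/-! ### Norming sets in finite dimension -/

/-- The unit ball of a finite-dimensional normed space has a subset of at most `5 ^ dim` points
which controls every linear functional up to a factor `2`. -/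
theorem exists_norming_finset (F : Type*) [NormedAddCommGroup F] [NormedSpace ℝ F]
    [FiniteDimensional ℝ F] :
    ∃ N : Finset F, N.card ≤ 5 ^ Module.finrank ℝ F ∧ (∀ x ∈ N, ‖x‖ ≤ 1) ∧
      ∀ (f : F →ₗ[ℝ] ℝ) (M : ℝ), 0 ≤ M → (∀ x ∈ N, |f x| ≤ M) → ∀ x, |f x| ≤ 2 * M * ‖x‖ := by
  classical
  let Q : Finset F → Prop := fun s =>
    (∀ c ∈ s, ‖c‖ ≤ 2) ∧ (∀ c ∈ s, ∀ d ∈ s, c ≠ d → 1 ≤ ‖c - d‖)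
  obtain ⟨s, hs, hmax⟩ : ∃ s, Q s ∧ ∀ t, Q t → t.card ≤ s.card := by
    let R : ℕ → Prop := fun k => ∃ s, Q s ∧ s.card = k
    have h0 : R 0 := ⟨∅, by simp [Q], rfl⟩
    have hR := Nat.findGreatest_spec (P := R) (Nat.zero_le (5 ^ Module.finrank ℝ F)) h0
    obtain ⟨s, hs, hc⟩ := hR
    refine ⟨s, hs, fun t ht => ?_⟩
    rw [hc]
    exact Nat.le_findGreatest (Besicovitch.card_le_of_separated t ht.1 ht.2) ⟨t, ht, rfl⟩
  have hcov : ∀ x : F, ‖x‖ ≤ 2 → ∃ c ∈ s, ‖x - c‖ ≤ 1 := by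
    intro x hx
    by_contra! hfar
    have hxs : x ∉ s := fun h => by
      have := hfar x h
      norm_num at this
    have hQ : Q (insert x s) := by
      refine ⟨?_, ?_⟩
      · intro c hc
        rcases Finset.mem_insert.1 hc with rfl | hc
        exacts [hx, hs.1 c hc]
      · intro c hc d hd hcd
        rcases Finset.mem_insert.1 hc with hcx | hc <;>
          rcases Finset.mem_insert.1 hd with hdx | hd
        · exact absurd (hcx.trans hdx.symm) hcd
        · rw [hcx]; exact (hfar d hd).le
        · rw [hdx, norm_sub_rev]; exact (hfar c hc).le
        · exact hs.2 c hc d hd hcd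
    have := hmax _ hQ
    rw [Finset.card_insert_of_notMem hxs] at this
    omega
  -- A maximal 1-separated set in the ball of radius 2 is a 1-net there; halving it gives a 1/2-net
  -- of the unit ball.
  refine ⟨s.image fun x => (1 / 2 : ℝ) • x,
    Finset.card_image_le.trans (Besicovitch.card_le_of_separated s hs.1 hs.2), ?_, ?_⟩
  · intro x hx
    obtain ⟨c, hc, rfl⟩ := Finset.mem_image.1 hx
    rw [norm_smul]
    have := hs.1 c hc
    norm_num
    linarith
  · intro f M hM hN
    let g : F →L[ℝ] ℝ := LinearMap.toContinuousLinearMap f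
    have hg : ‖g‖ ≤ M + ‖g‖ / 2 := by
      refine ContinuousLinearMap.opNorm_le_of_unit_norm (by positivity) fun y hy => ?_
      obtain ⟨c, hc, hyc⟩ := hcov ((2 : ℝ) • y) (by rw [norm_smul, hy]; norm_num)
      have h1 : |g ((1 / 2 : ℝ) • c)| ≤ M := hN _ (Finset.mem_image_of_mem _ hc)
      have h2 : ‖g (y - (1 / 2 : ℝ) • c)‖ ≤ ‖g‖ / 2 := by
        refine (g.le_opNorm _).trans ?_
        have : y - (1 / 2 : ℝ) • c = (1 / 2 : ℝ) • ((2 : ℝ) • y - c) := by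
          rw [smul_sub, smul_smul]; norm_num
        rw [this, norm_smul]
        have := norm_nonneg g
        norm_num
        nlinarith
      have h3 : g y = g ((1 / 2 : ℝ) • c) + g (y - (1 / 2 : ℝ) • c) := by
        rw [← map_add]; congr 1; abel
      rw [h3]
      exact (norm_add_le _ _).trans (add_le_add h1 h2)
    intro x
    calc |f x| = ‖g x‖ := rfl
      _ ≤ ‖g‖ * ‖x‖ := g.le_opNorm x
      _ ≤ 2 * M * ‖x‖ := by gcongr; linarith

/-! ### Tails of scalar sub-Gaussian variables -/

section Scalar

variable {Ω : Type*} [MeasurableSpace Ω] {P : Measure Ω} [IsProbabilityMeasure P] {Z : Ω → ℝ}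

/-- Square-exponential integrability of a variable with Gaussian tails. -/
theorem IsSubGaussian.exists_lintegral_ne_top (hZ : Measurable Z) (h : IsSubGaussian P Z) :
    ∃ l > 0, ∫⁻ ω, ENNReal.ofReal (Real.exp (l * Z ω ^ 2)) ∂P ≠ ⊤ := by
  obtain ⟨C, hC, c, hc, htail⟩ := h
  -- On the layer |Z| ∈ [k, k+1) with k ≥ 1 one has (k+1)² ≤ 4k², so the rate c/8 uses at most half
  -- of the tail exponent ck², and a geometric series remains.
  refine ⟨c / 8, by positivity, ?_⟩
  set A : ℕ → Set Ω := fun k => {ω | (k : ℝ) ≤ |Z ω|}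
  have hA : ∀ k, MeasurableSet (A k) := fun k => measurableSet_le measurable_const hZ.abs
  have hle : ∀ ω, ENNReal.ofReal (Real.exp (c / 8 * Z ω ^ 2)) ≤
      ∑' k : ℕ, (A k).indicator
        (fun _ => ENNReal.ofReal (Real.exp (c / 8 * ((k : ℝ) + 1) ^ 2))) ω := by
    intro ω
    refine le_trans ?_ (ENNReal.le_tsum ⌊|Z ω|⌋₊)
    rw [Set.indicator_of_mem (show ω ∈ A ⌊|Z ω|⌋₊ from Set.mem_ofPred_eq ▸ Nat.floor_le (abs_nonneg _))]
    have h1 := (Nat.lt_floor_add_one |Z ω|).le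
    rw [← sq_abs (Z ω)]
    gcongr
  refine ne_top_of_le_ne_top ?_ (lintegral_mono hle)
  rw [lintegral_tsum fun k => (measurable_const.indicator (hA k)).aemeasurable]
  have hsum : Summable fun k : ℕ => (Real.exp (c / 8) + C) * Real.exp (-(c / 2)) ^ k := by
    refine Summable.mul_left _ (summable_geometric_of_lt_one (Real.exp_pos _).le ?_)
    rw [Real.exp_lt_one_iff]; linarith
  refine ne_top_of_le_ne_top hsum.tsum_ofReal_ne_top (ENNReal.tsum_le_tsum fun k => ?_)
  rw [lintegral_indicator_const (hA k), ← ofReal_measureReal,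
    ← ENNReal.ofReal_mul (Real.exp_pos _).le]
  apply ENNReal.ofReal_le_ofReal
  rcases Nat.eq_zero_or_pos k with rfl | hk
  · have : P.real (A 0) ≤ 1 := measureReal_le_one
    have h2 := Real.exp_pos (c / 8)
    norm_num
    nlinarith
  · have hk1 : (1 : ℝ) ≤ k := by exact_mod_cast hk
    have h1 := htail k (by linarith)
    calc Real.exp (c / 8 * ((k : ℝ) + 1) ^ 2) * P.real (A k)
        ≤ Real.exp (c / 8 * ((k : ℝ) + 1) ^ 2) * (C * Real.exp (-c * (k : ℝ) ^ 2)) := by gcongr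
      _ = C * Real.exp (c / 8 * ((k : ℝ) + 1) ^ 2 + -c * (k : ℝ) ^ 2) := by
          rw [Real.exp_add]; ring
      _ ≤ C * Real.exp (k * (-(c / 2))) := by
          gcongr
          nlinarith [mul_nonneg hc.le (sub_nonneg.2 hk1), mul_nonneg hc.le
            (mul_nonneg (sub_nonneg.2 hk1) (sub_nonneg.2 hk1))]
      _ ≤ _ := by
          rw [Real.exp_nat_mul]
          gcongr
          linarith [Real.exp_pos (c / 8)]

/-- The set in the definition of the scale is nonempty for a sub-Gaussian variable. -/
theorem IsSubGaussian.exists_scale (hZ : Measurable Z) (h : IsSubGaussian P Z) :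
    ∃ s : ℝ, 0 < s ∧ ∫⁻ ω, ENNReal.ofReal (Real.exp (Z ω ^ 2 / s ^ 2)) ∂P ≤ 2 := by
  obtain ⟨l, hl, hint⟩ := h.exists_lintegral_ne_top hZ
  have ht : Filter.Tendsto
      (fun k : ℕ => ∫⁻ ω, ENNReal.ofReal (Real.exp (l * Z ω ^ 2 * (1 / ((k : ℝ) + 1)))) ∂P)
      Filter.atTop (nhds (∫⁻ _, ENNReal.ofReal (Real.exp 0) ∂P)) := by
    refine tendsto_lintegral_of_dominated_convergence _ (fun k => by fun_prop)
      (fun k => Filter.Eventually.of_forall fun ω => ?_) hint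
      (Filter.Eventually.of_forall fun ω => ?_)
    · apply ENNReal.ofReal_le_ofReal
      apply Real.exp_le_exp.2
      have h0 : 0 ≤ l * Z ω ^ 2 := by positivity
      have h1 : 1 / ((k : ℝ) + 1) ≤ 1 := by
        rw [div_le_one (by positivity)]; linarith [(Nat.cast_nonneg k : (0 : ℝ) ≤ k)]
      exact mul_le_of_le_one_right h0 h1
    · refine (ENNReal.continuous_ofReal.tendsto _).comp ((Real.continuous_exp.tendsto _).comp ?_)
      simpa using (tendsto_one_div_add_atTop_nhds_zero_nat (𝕜 := ℝ)).const_mul (l * Z ω ^ 2)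
  have h1 : ∫⁻ _, ENNReal.ofReal (Real.exp 0) ∂P = 1 := by simp
  rw [h1] at ht
  obtain ⟨k, hk⟩ := (ht.eventually (gt_mem_nhds (show (1 : ℝ≥0∞) < 2 by norm_num))).exists
  refine ⟨√(((k : ℝ) + 1) / l), by positivity, ?_⟩
  refine le_of_eq_of_le (lintegral_congr fun ω => ?_) hk.le
  rw [Real.sq_sqrt (by positivity)]
  congr 2
  field_simp

theorem measureReal_le_abs_of_lintegral_le {s t : ℝ} (hZ : Measurable Z) (ht : 0 ≤ t)
    (h : ∫⁻ ω, ENNReal.ofReal (Real.exp (Z ω ^ 2 / s ^ 2)) ∂P ≤ 2) :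
    P.real {ω | t ≤ |Z ω|} ≤ 2 * Real.exp (-(t ^ 2 / s ^ 2)) := by
  have hm := mul_meas_ge_le_lintegral (μ := P)
    (f := fun ω => ENNReal.ofReal (Real.exp (Z ω ^ 2 / s ^ 2))) (by fun_prop)
    (ENNReal.ofReal (Real.exp (t ^ 2 / s ^ 2)))
  have hsub : {ω | t ≤ |Z ω|} ⊆ {ω | ENNReal.ofReal (Real.exp (t ^ 2 / s ^ 2)) ≤
      ENNReal.ofReal (Real.exp (Z ω ^ 2 / s ^ 2))} := by
    intro ω hω
    simp only [Set.mem_ofPred_eq] at hω ⊢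
    rw [← sq_abs (Z ω)]
    gcongr
  have h2 : ENNReal.ofReal (Real.exp (t ^ 2 / s ^ 2)) * P {ω | t ≤ |Z ω|} ≤ 2 :=
    (mul_le_mul_right (measure_mono hsub) _).trans (hm.trans h)
  rw [← ofReal_measureReal, ← ENNReal.ofReal_mul (Real.exp_pos _).le,
    show (2 : ℝ≥0∞) = ENNReal.ofReal 2 by simp, ENNReal.ofReal_le_ofReal_iff (by norm_num)] at h2
  rw [Real.exp_neg, ← div_eq_mul_inv, le_div_iff₀ (Real.exp_pos _)]
  linarith

/-- The scale is an infimum, so an admissible parameter is only taken below a strictly larger `s`.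
Nonemptiness of the set matters: over ℝ the infimum of the empty set is 0. -/
theorem measureReal_le_abs_of_scale_lt {s t : ℝ} (hZ : Measurable Z) (h : IsSubGaussian P Z)
    (hs : subGaussianScale P Z < s) (ht : 0 ≤ t) :
    P.real {ω | t ≤ |Z ω|} ≤ 2 * Real.exp (-(t ^ 2 / s ^ 2)) := by
  obtain ⟨s', ⟨hs'0, hs'⟩, hlt⟩ := exists_lt_of_csInf_lt (h.exists_scale hZ) hs
  refine (measureReal_le_abs_of_lintegral_le hZ ht hs').trans ?_
  gcongr

/-- Tail bound for a sub-Gaussian variable of scale at most `σ`, including `σ = 0`. -/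
theorem measureReal_lt_abs_of_scale_le {σ u : ℝ} (hZ : Measurable Z) (h : IsSubGaussian P Z)
    (hσ : 0 ≤ σ) (hs : subGaussianScale P Z ≤ σ) (hu : 0 ≤ u) :
    P.real {ω | σ * u < |Z ω|} ≤ 2 * Real.exp (-(u ^ 2 / 4)) := by
  rcases hσ.eq_or_lt with rfl | hσ
  · have h0 : ∀ t > 0, P.real {ω | t ≤ |Z ω|} = 0 := by
      intro t ht
      by_contra hne
      have hpos : 0 < P.real {ω | t ≤ |Z ω|} := lt_of_le_of_ne measureReal_nonneg (Ne.symm hne)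
      set y := P.real {ω | t ≤ |Z ω|}
      -- With scale 0 every s > 0 is allowed. This s makes t²/s² = 2/y, so y · exp(2/y) ≤ 2, against
      -- exp(2/y) ≥ 1 + 2/y.
      have hb := measureReal_le_abs_of_scale_lt (s := t / √(2 / y)) hZ h
        (hs.trans_lt (by positivity)) ht.le
      rw [div_pow, Real.sq_sqrt (by positivity), div_div_cancel₀ (by positivity),
        Real.exp_neg, ← div_eq_mul_inv, le_div_iff₀ (Real.exp_pos _)] at hb
      have h1 := Real.add_one_le_exp (2 / y)
      have h2 : y * (2 / y + 1) ≤ 2 := (mul_le_mul_of_nonneg_left h1 hpos.le).trans hb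
      have h3 : y * (2 / y + 1) = 2 + y := by field_simp
      linarith
    have hnull : P {ω | 0 * u < |Z ω|} = 0 := by
      have : {ω | 0 * u < |Z ω|} ⊆ ⋃ k : ℕ, {ω | 1 / ((k : ℝ) + 1) ≤ |Z ω|} := by
        intro ω hω
        simp only [zero_mul, Set.mem_ofPred_eq] at hω
        obtain ⟨k, hk⟩ := exists_nat_one_div_lt hω
        exact Set.mem_iUnion.2 ⟨k, hk.le⟩
      refine measure_mono_null this (measure_iUnion_null fun k => ?_)
      exact (measureReal_eq_zero_iff).1 (h0 _ (by positivity))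
    rw [Measure.real, hnull]
    simp only [ENNReal.toReal_zero]
    positivity
  · have h1 := measureReal_le_abs_of_scale_lt (s := 2 * σ) hZ h (by linarith)
      (mul_nonneg hσ.le hu)
    have h2 : (σ * u) ^ 2 / (2 * σ) ^ 2 = u ^ 2 / 4 := by field_simp; norm_num
    rw [h2] at h1
    refine le_trans (measureReal_mono (fun ω hω => ?_) (measure_ne_top _ _)) h1
    simp only [Set.mem_ofPred_eq] at hω ⊢
    exact hω.le

end Scalar
-- Noise against low-rank families in a fixed subspace
/-- The `k`-th column of a matrix as a Euclidean vector. -/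
noncomputable def colVec {n m : ℕ} (M : Matrix (Fin n) (Fin m) ℝ) (k : Fin m) : EuclideanSpace ℝ (Fin n) :=
  WithLp.toLp 2 fun i => M i k

/-- The Frobenius pairing of a matrix with a family of columns. -/
noncomputable def pairing {n m : ℕ} (M : Matrix (Fin n) (Fin m) ℝ) (b : Fin m → EuclideanSpace ℝ (Fin n)) : ℝ :=
  ∑ k, inner ℝ (colVec M k) (b k)

theorem pairing_eq_sum {n m : ℕ} (M : Matrix (Fin n) (Fin m) ℝ)
    (b : Fin m → EuclideanSpace ℝ (Fin n)) : pairing M b = ∑ k, ∑ i, M i k * b k i := by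
  unfold pairing colVec
  refine Finset.sum_congr rfl fun k _ => ?_
  rw [PiLp.inner_apply]
  refine Finset.sum_congr rfl fun i _ => ?_
  simp [mul_comm]

theorem pairing_eq_vec_dotProduct {n m : ℕ} (M : Matrix (Fin n) (Fin m) ℝ)
    (b : Fin m → EuclideanSpace ℝ (Fin n)) : pairing M b = M.vec ⬝ᵥ fun ki => b ki.1 ki.2 := by
  rw [pairing_eq_sum, dotProduct, Fintype.sum_prod_type]
  rfl

section Noise

variable {n m : ℕ} {Ω : Type*} [MeasurableSpace Ω] {P : Measure Ω} [IsProbabilityMeasure P]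
  {E : Ω → Matrix (Fin n) (Fin m) ℝ} {σ : ℝ}

theorem measurable_pairing (hE : ∀ i k, Measurable fun ω => E ω i k)
    (b : Fin m → EuclideanSpace ℝ (Fin n)) : Measurable fun ω => pairing (E ω) b := by
  simp only [pairing_eq_sum]
  exact Finset.measurable_sum _ fun k _ => Finset.measurable_sum _ fun i _ =>
    (hE i k).mul_const _

theorem measureReal_lt_abs_pairing_le (hE : ∀ i k, Measurable fun ω => E ω i k) (hσ : 0 ≤ σ)
    (hsg : IsSubGaussianVector P (fun ω => (E ω).vec) σ) {b : Fin m → EuclideanSpace ℝ (Fin n)}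
    (hb : ∑ k, ‖b k‖ ^ 2 ≤ 1) {u : ℝ} (hu : 0 ≤ u) :
    P.real {ω | σ * u < |pairing (E ω) b|} ≤ 2 * Real.exp (-(u ^ 2 / 4)) := by
  obtain ⟨h1, h2⟩ := hsg fun ki => b ki.1 ki.2
  simp only [← pairing_eq_vec_dotProduct] at h1 h2
  refine measureReal_lt_abs_of_scale_le (measurable_pairing hE b) h1 hσ (h2.trans ?_) hu
  refine mul_le_of_le_one_right hσ (Real.sqrt_le_one.2 ?_)
  rw [Fintype.sum_prod_type]
  simpa [EuclideanSpace.norm_sq_eq] using hb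

theorem finrank_clm_euclideanSpace (r : ℕ) {G : Type*} [NormedAddCommGroup G] [NormedSpace ℝ G]
    [FiniteDimensional ℝ G] :
    Module.finrank ℝ (EuclideanSpace ℝ (Fin r) →L[ℝ] G) = r * Module.finrank ℝ G := by
  rw [← (LinearMap.toContinuousLinearMap (𝕜 := ℝ) (E := EuclideanSpace ℝ (Fin r))
    (F' := G)).finrank_eq, Module.finrank_linearMap, finrank_euclideanSpace_fin]

theorem finrank_piLp_euclideanSpace (m r : ℕ) :
    Module.finrank ℝ (PiLp 2 fun _ : Fin m => EuclideanSpace ℝ (Fin r)) = m * r := by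
  rw [(WithLp.linearEquiv 2 ℝ (Fin m → EuclideanSpace ℝ (Fin r))).finrank_eq,
    Module.finrank_pi_fintype]
  simp

/-- Pairing with `U V`, as a linear functional of `U`. -/
noncomputable def pairingLeft {r : ℕ} {S : Submodule ℝ (EuclideanSpace ℝ (Fin n))}
    (M : Matrix (Fin n) (Fin m) ℝ) (V : PiLp 2 fun _ : Fin m => EuclideanSpace ℝ (Fin r)) :
    (EuclideanSpace ℝ (Fin r) →L[ℝ] S) →ₗ[ℝ] ℝ where
  toFun U := pairing M fun k => (U (V k) : EuclideanSpace ℝ (Fin n))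
  map_add' U U' := by simp [pairing, inner_add_right, Finset.sum_add_distrib]
  map_smul' a U := by simp [pairing, inner_smul_right, Finset.mul_sum]

/-- Pairing with `U V`, as a linear functional of `V`. -/
noncomputable def pairingRight {r : ℕ} {S : Submodule ℝ (EuclideanSpace ℝ (Fin n))}
    (M : Matrix (Fin n) (Fin m) ℝ) (U : EuclideanSpace ℝ (Fin r) →L[ℝ] S) :
    (PiLp 2 fun _ : Fin m => EuclideanSpace ℝ (Fin r)) →ₗ[ℝ] ℝ where
  toFun V := pairing M fun k => (U (V k) : EuclideanSpace ℝ (Fin n))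
  map_add' V V' := by simp [pairing, inner_add_right, Finset.sum_add_distrib]
  map_smul' a V := by simp [pairing, inner_smul_right, Finset.mul_sum]

/-- A family of vectors in an `r`-dimensional subspace of `S` factors isometrically through
`ℝ^r`. -/
theorem exists_factorization {r : ℕ} {S W : Submodule ℝ (EuclideanSpace ℝ (Fin n))} (hWS : W ≤ S)
    (hr : Module.finrank ℝ W = r) (b : Fin m → EuclideanSpace ℝ (Fin n)) (hb : ∀ k, b k ∈ W) :
    ∃ (U : EuclideanSpace ℝ (Fin r) →L[ℝ] S)
      (V : PiLp 2 fun _ : Fin m => EuclideanSpace ℝ (Fin r)), ‖U‖ ≤ 1 ∧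
      (∀ k, (U (V k) : EuclideanSpace ℝ (Fin n)) = b k) ∧ ‖V‖ = √(∑ k, ‖b k‖ ^ 2) := by
  subst hr
  let e := (stdOrthonormalBasis ℝ W).repr
  let U : EuclideanSpace ℝ (Fin (Module.finrank ℝ W)) →ₗ[ℝ] S :=
    (Submodule.inclusion hWS).comp e.symm.toLinearEquiv.toLinearMap
  have hU : ∀ x, ‖U x‖ = ‖x‖ := fun x => by
    have : ‖U x‖ = ‖e.symm x‖ := rfl
    rw [this, LinearIsometryEquiv.norm_map]
  refine ⟨LinearMap.toContinuousLinearMap U, WithLp.toLp 2 fun k => e ⟨b k, hb k⟩, ?_, ?_, ?_⟩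
  · refine ContinuousLinearMap.opNorm_le_bound _ zero_le_one fun x => ?_
    rw [one_mul]
    exact (hU x).le
  · intro k
    change ((e.symm (e ⟨b k, hb k⟩) : W) : EuclideanSpace ℝ (Fin n)) = b k
    rw [LinearIsometryEquiv.symm_apply_apply]
  · rw [PiLp.norm_eq_of_L2]
    simp

theorem sum_norm_sq_factorization_le {r : ℕ} {S : Submodule ℝ (EuclideanSpace ℝ (Fin n))}
    {U : EuclideanSpace ℝ (Fin r) →L[ℝ] S} {V : PiLp 2 fun _ : Fin m => EuclideanSpace ℝ (Fin r)}
    (hU : ‖U‖ ≤ 1) (hV : ‖V‖ ≤ 1) :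
    ∑ k, ‖(U (V k) : EuclideanSpace ℝ (Fin n))‖ ^ 2 ≤ 1 := by
  have h1 : ∑ k, ‖V k‖ ^ 2 ≤ 1 := by
    rw [← PiLp.norm_sq_eq_of_L2]
    exact pow_le_one₀ (norm_nonneg _) hV
  refine le_trans (Finset.sum_le_sum fun k _ => ?_) h1
  have h2 : ‖U (V k)‖ ≤ ‖V k‖ := (U.le_opNorm _).trans (mul_le_of_le_one_left (norm_nonneg _) hU)
  exact pow_le_pow_left₀ (norm_nonneg _) h2 2

/-- Uniform deviation bound for the noise over families of columns which span an
`r`-dimensional subspace of `S`. -/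
theorem measureReal_lowRank_pairing_le (hE : ∀ i k, Measurable fun ω => E ω i k) (hσ : 0 ≤ σ)
    (hsg : IsSubGaussianVector P (fun ω => (E ω).vec) σ)
    (S : Submodule ℝ (EuclideanSpace ℝ (Fin n))) (r : ℕ) {u : ℝ} (hu : 0 ≤ u) :
    P.real {ω | ∃ W ≤ S, Module.finrank ℝ W = r ∧ ∃ b : Fin m → EuclideanSpace ℝ (Fin n),
        (∀ k, b k ∈ W) ∧ 4 * (σ * u) * √(∑ k, ‖b k‖ ^ 2) < pairing (E ω) b} ≤
      (5 : ℝ) ^ ((Module.finrank ℝ S + m) * r) * (2 * Real.exp (-(u ^ 2 / 4))) := by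
  have : FiniteDimensional ℝ (EuclideanSpace ℝ (Fin r) →L[ℝ] S) :=
    (LinearMap.toContinuousLinearMap (𝕜 := ℝ) (E := EuclideanSpace ℝ (Fin r))
      (F' := S)).finiteDimensional
  obtain ⟨N₁, hc₁, hb₁, hf₁⟩ := exists_norming_finset (EuclideanSpace ℝ (Fin r) →L[ℝ] S)
  obtain ⟨N₂, hc₂, hb₂, hf₂⟩ :=
    exists_norming_finset (PiLp 2 fun _ : Fin m => EuclideanSpace ℝ (Fin r))
  rw [finrank_clm_euclideanSpace] at hc₁
  rw [finrank_piLp_euclideanSpace] at hc₂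
  have hsu : 0 ≤ σ * u := mul_nonneg hσ hu
  have hsub : {ω | ∃ W ≤ S, Module.finrank ℝ W = r ∧ ∃ b : Fin m → EuclideanSpace ℝ (Fin n),
        (∀ k, b k ∈ W) ∧ 4 * (σ * u) * √(∑ k, ‖b k‖ ^ 2) < pairing (E ω) b} ⊆
      ⋃ UV ∈ N₁ ×ˢ N₂, {ω | σ * u <
        |pairing (E ω) fun k => (UV.1 (UV.2 k) : EuclideanSpace ℝ (Fin n))|} := by
    rintro ω ⟨W, hWS, hr, b, hb, hlt⟩
    by_contra hno
    simp only [Set.mem_iUnion, Set.mem_ofPred_eq, not_exists, not_lt] at hno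
    obtain ⟨U, V, hU, hUV, hV⟩ := exists_factorization hWS hr b hb
    -- The pairing is bilinear in (U, V): with V in its net, pass from the net to the actual U, then
    -- with that U to the actual V. Each passage costs a factor 2, hence the 4 in the statement.
    have h1 : ∀ V ∈ N₂, |pairingRight (E ω) U V| ≤ 2 * (σ * u) := by
      intro V hV
      refine (hf₁ (pairingLeft (E ω) V) (σ * u) hsu (fun U' hU' => ?_) U).trans
        (mul_le_of_le_one_right (by positivity) hU)
      exact hno (U', V) (Finset.mem_product.2 ⟨hU', hV⟩)
    have h2 := hf₂ (pairingRight (E ω) U) (2 * (σ * u)) (by positivity) h1 V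
    have h3 : pairingRight (E ω) U V = pairing (E ω) b := by
      change pairing (E ω) (fun k => (U (V k) : EuclideanSpace ℝ (Fin n))) = _
      simp only [hUV]
    rw [h3, hV] at h2
    have h4 := le_abs_self (pairing (E ω) b)
    linarith
  refine (measureReal_mono hsub (measure_ne_top _ _)).trans ?_
  refine (measureReal_biUnion_finset_le _ _).trans ?_
  refine (Finset.sum_le_card_nsmul _ _ (2 * Real.exp (-(u ^ 2 / 4))) fun UV hUV => ?_).trans ?_
  · obtain ⟨hU, hV⟩ := Finset.mem_product.1 hUV
    exact measureReal_lt_abs_pairing_le hE hσ hsg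
      (sum_norm_sq_factorization_le (hb₁ _ hU) (hb₂ _ hV)) hu
  · rw [nsmul_eq_mul]
    gcongr
    rw [Finset.card_product]
    have h := Nat.mul_le_mul hc₁ hc₂
    rw [← pow_add] at h
    rw [show (Module.finrank ℝ S + m) * r = r * Module.finrank ℝ S + m * r by ring]
    exact_mod_cast h

end Noise
-- Counting supports
/-- The inflation term `J log (e p / J)` of the complexity. -/
noncomputable def logTerm (p J : ℕ) : ℝ := (J : ℝ) * Real.log (Real.exp 1 * (p : ℝ) / (J : ℝ))

theorem logTerm_eq {p J : ℕ} (hJ : 1 ≤ J) (hp : J ≤ p) :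
    logTerm p J = J * (1 + Real.log p - Real.log J) := by
  have hJ' : (J : ℝ) ≠ 0 := by positivity
  have hp' : (p : ℝ) ≠ 0 := by
    have : 0 < p := by omega
    positivity
  rw [logTerm, Real.log_div (by positivity) hJ', Real.log_mul (Real.exp_pos 1).ne' hp',
    Real.log_exp]

theorem log_le_log_of_card_le {p J : ℕ} (hJ : 1 ≤ J) (hp : J ≤ p) :
    Real.log J ≤ Real.log p :=
  Real.log_le_log (by exact_mod_cast hJ) (by exact_mod_cast hp)

/-- The difference of the two sides is (J - 1)(log p - log J) + (J - 1 - log J), a sum of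
nonnegative terms. It turns confidence `logTerm` into a power of 1/p. -/
theorem one_add_log_le_logTerm {p J : ℕ} (hJ : 1 ≤ J) (hp : J ≤ p) :
    1 + Real.log p ≤ logTerm p J := by
  rw [logTerm_eq hJ hp]
  have h1 := log_le_log_of_card_le hJ hp
  have hJ1 : (1 : ℝ) ≤ J := by exact_mod_cast hJ
  have h2 := Real.log_le_sub_one_of_pos (show (0 : ℝ) < J by linarith)
  nlinarith [mul_nonneg (sub_nonneg.2 hJ1) (sub_nonneg.2 h1)]

theorem natCast_le_logTerm {p J : ℕ} (hJ : 1 ≤ J) (hp : J ≤ p) : (J : ℝ) ≤ logTerm p J := by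
  rw [logTerm_eq hJ hp]
  have h1 := log_le_log_of_card_le hJ hp
  have hJ1 : (1 : ℝ) ≤ J := by exact_mod_cast hJ
  nlinarith

theorem logTerm_nonneg {p J : ℕ} (hp : J ≤ p) : 0 ≤ logTerm p J := by
  rcases Nat.eq_zero_or_pos J with rfl | hJ
  · simp [logTerm]
  · exact (Nat.cast_nonneg J).trans (natCast_le_logTerm hJ hp)

/-- p^J / J! = (J^J / J!) (p/J)^J, and J^J / J! ≤ e^J. -/
theorem choose_le_exp_logTerm {p J : ℕ} (hJ : 1 ≤ J) (hp : J ≤ p) :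
    (p.choose J : ℝ) ≤ Real.exp (logTerm p J) := by
  have hJ' : (0 : ℝ) < J := by exact_mod_cast hJ
  have hp' : (0 : ℝ) < p := by exact_mod_cast lt_of_lt_of_le hJ hp
  have h1 : (p.choose J : ℝ) ≤ (p : ℝ) ^ J / J.factorial := Nat.choose_le_pow_div J p
  have h2 := Real.pow_div_factorial_le_exp (J : ℝ) hJ'.le J
  have h3 : Real.exp (logTerm p J) = Real.exp J * ((p : ℝ) / J) ^ J := by
    rw [logTerm, Real.exp_nat_mul, Real.exp_log (by positivity), mul_div_assoc, mul_pow,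
      ← Real.exp_nat_mul, mul_one]
  rw [h3]
  refine h1.trans ?_
  calc (p : ℝ) ^ J / J.factorial = (J : ℝ) ^ J / J.factorial * ((p : ℝ) / J) ^ J := by
        rw [div_pow]; field_simp
    _ ≤ _ := by gcongr

theorem two_mul_exp_neg_logTerm_le {p J : ℕ} (hJ : 1 ≤ J) (hp : J ≤ p) :
    2 * Real.exp (-4 * logTerm p J) ≤ 2 / p := by
  have hp' : (0 : ℝ) < p := by exact_mod_cast lt_of_lt_of_le hJ hp
  have h1 := one_add_log_le_logTerm hJ hp
  have h2 : Real.exp (-4 * logTerm p J) ≤ Real.exp (-Real.log p) := by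
    apply Real.exp_le_exp.2
    have : 0 ≤ Real.log p := Real.log_natCast_nonneg p
    linarith
  rw [Real.exp_neg, Real.exp_log hp'] at h2
  rw [div_eq_mul_inv]
  linarith

/-- Of the four copies of `logTerm` in the exponent, one pays for the supports of size J, one for
the J + 1 ranks, and two leave 2/p², which can still be summed over p sizes. -/
theorem choose_mul_exp_neg_logTerm_le {p J : ℕ} (hJ : 1 ≤ J) (hp : J ≤ p) :
    (p.choose J : ℝ) * (((J : ℝ) + 1) * (2 * Real.exp (-4 * logTerm p J))) ≤
      2 / (p : ℝ) ^ 2 := by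
  have hp' : (0 : ℝ) < p := by exact_mod_cast lt_of_lt_of_le hJ hp
  have h1 := choose_le_exp_logTerm hJ hp
  have h2 : (J : ℝ) + 1 ≤ Real.exp (logTerm p J) :=
    (Real.add_one_le_exp _).trans (Real.exp_le_exp.2 (natCast_le_logTerm hJ hp))
  calc (p.choose J : ℝ) * (((J : ℝ) + 1) * (2 * Real.exp (-4 * logTerm p J)))
      ≤ Real.exp (logTerm p J) * (Real.exp (logTerm p J) *
          (2 * Real.exp (-4 * logTerm p J))) := by gcongr
    _ = 2 * Real.exp (-2 * logTerm p J) := by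
        rw [show -4 * logTerm p J = -logTerm p J + -logTerm p J + -2 * logTerm p J by ring,
          Real.exp_add, Real.exp_add, Real.exp_neg]
        field_simp
    _ ≤ 2 * Real.exp (-(2 : ℕ) * Real.log p) := by
        refine mul_le_mul_of_nonneg_left (Real.exp_le_exp.2 ?_) zero_le_two
        have := one_add_log_le_logTerm hJ hp
        push_cast
        linarith
    _ = 2 / (p : ℝ) ^ 2 := by
        rw [neg_mul, Real.exp_neg, Real.exp_nat_mul, Real.exp_log hp', div_eq_mul_inv]

theorem sum_nonempty_exp_neg_logTerm_le {p : ℕ} (hp : 0 < p) :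
    ∑ J ∈ (Finset.univ : Finset (Finset (Fin p))).filter Finset.Nonempty,
      (((J.card : ℝ) + 1) * (2 * Real.exp (-4 * logTerm p J.card))) ≤ 2 / p := by
  have hp' : (0 : ℝ) < p := by exact_mod_cast hp
  let g : ℕ → ℝ := fun J =>
    if J = 0 then 0 else ((J : ℝ) + 1) * (2 * Real.exp (-4 * logTerm p J))
  have h1 : ∑ J ∈ (Finset.univ : Finset (Finset (Fin p))).filter Finset.Nonempty,
      (((J.card : ℝ) + 1) * (2 * Real.exp (-4 * logTerm p J.card))) =
      ∑ J ∈ (Finset.univ : Finset (Fin p)).powerset, g J.card := by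
    rw [Finset.powerset_univ, Finset.sum_filter]
    refine Finset.sum_congr rfl fun J _ => ?_
    by_cases hJ : J = ∅
    · simp [hJ, g]
    · simp [g, hJ, Finset.nonempty_iff_ne_empty]
  rw [h1, Finset.sum_powerset_apply_card, Finset.card_univ, Fintype.card_fin,
    Finset.sum_range_succ']
  have h2 : ∀ i ∈ Finset.range p, p.choose (i + 1) • g (i + 1) ≤ 2 / (p : ℝ) ^ 2 := by
    intro i hi
    have := choose_mul_exp_neg_logTerm_le (p := p) (J := i + 1) (by omega)
      (by have := Finset.mem_range.1 hi; omega)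
    simpa [g, nsmul_eq_mul] using this
  have h3 := Finset.sum_le_card_nsmul _ _ _ h2
  rw [Finset.card_range, nsmul_eq_mul] at h3
  have h4 : (p : ℝ) * (2 / (p : ℝ) ^ 2) = 2 / p := by field_simp
  simp only [g, if_true, smul_zero, add_zero]
  rw [h4] at h3
  exact h3

/-! ### Noise level and union bound over supports and ranks -/

section Noise

variable {n m p : ℕ} {Ω : Type*} [MeasurableSpace Ω] {P : Measure Ω} [IsProbabilityMeasure P]
  {E : Ω → Matrix (Fin n) (Fin m) ℝ} {σ : ℝ}

/-- The noise level of the families of columns in an `r`-dimensional subspace of an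
`s`-dimensional space, at confidence `t`. -/
noncomputable def noiseLevel (s m r : ℕ) (t : ℝ) : ℝ := √(16 * (((s : ℝ) + m) * r + t))

theorem noiseLevel_sq {s m r : ℕ} {t : ℝ} (ht : 0 ≤ t) :
    noiseLevel s m r t ^ 2 = 16 * (((s : ℝ) + m) * r + t) :=
  Real.sq_sqrt (by positivity)

theorem measureReal_noiseLevel_lt_pairing_le (hE : ∀ i k, Measurable fun ω => E ω i k)
    (hσ : 0 ≤ σ) (hsg : IsSubGaussianVector P (fun ω => (E ω).vec) σ)
    (S : Submodule ℝ (EuclideanSpace ℝ (Fin n))) (r : ℕ) {t : ℝ} (ht : 0 ≤ t) :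
    P.real {ω | ∃ W ≤ S, Module.finrank ℝ W = r ∧ ∃ b : Fin m → EuclideanSpace ℝ (Fin n),
        (∀ k, b k ∈ W) ∧ 4 * (σ * noiseLevel (Module.finrank ℝ S) m r t) *
          √(∑ k, ‖b k‖ ^ 2) < pairing (E ω) b} ≤ 2 * Real.exp (-4 * t) := by
  refine (measureReal_lowRank_pairing_le hE hσ hsg S r (Real.sqrt_nonneg _)).trans ?_
  rw [Real.sq_sqrt (by positivity)]
  -- The squared level over 4 is 4((s + m) r + t): its first part cancels the net cardinality
  -- because 5 ≤ e⁴.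
  have h5 : (5 : ℝ) ≤ Real.exp 4 := by
    have := Real.add_one_le_exp (4 : ℝ)
    linarith
  calc (5 : ℝ) ^ ((Module.finrank ℝ S + m) * r) *
        (2 * Real.exp (-(16 * (((Module.finrank ℝ S : ℝ) + m) * r + t) / 4)))
      ≤ Real.exp 4 ^ ((Module.finrank ℝ S + m) * r) *
        (2 * Real.exp (-(16 * (((Module.finrank ℝ S : ℝ) + m) * r + t) / 4))) := by gcongr
    _ = 2 * Real.exp (-4 * t) := by
        rw [← Real.exp_nat_mul, mul_left_comm, ← Real.exp_add]
        push_cast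
        congr 2
        ring

theorem measureReal_exists_support_pairing_le (hE : ∀ i k, Measurable fun ω => E ω i k)
    (hσ : 0 ≤ σ) (hsg : IsSubGaussianVector P (fun ω => (E ω).vec) σ) (hp : 0 < p)
    (S : Finset (Fin p) → Submodule ℝ (EuclideanSpace ℝ (Fin n)))
    (hS : ∀ J, Module.finrank ℝ (S J) ≤ J.card) :
    P.real {ω | ∃ J : Finset (Fin p), J.Nonempty ∧ ∃ W ≤ S J,
        ∃ b : Fin m → EuclideanSpace ℝ (Fin n), (∀ k, b k ∈ W) ∧
          4 * (σ * noiseLevel (Module.finrank ℝ (S J)) m (Module.finrank ℝ W)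
            (logTerm p J.card)) * √(∑ k, ‖b k‖ ^ 2) < pairing (E ω) b} ≤ 2 / p := by
  have hsub : {ω | ∃ J : Finset (Fin p), J.Nonempty ∧ ∃ W ≤ S J,
        ∃ b : Fin m → EuclideanSpace ℝ (Fin n), (∀ k, b k ∈ W) ∧
          4 * (σ * noiseLevel (Module.finrank ℝ (S J)) m (Module.finrank ℝ W)
            (logTerm p J.card)) * √(∑ k, ‖b k‖ ^ 2) < pairing (E ω) b} ⊆
      ⋃ J ∈ (Finset.univ : Finset (Finset (Fin p))).filter Finset.Nonempty,
        ⋃ r ∈ Finset.range (J.card + 1),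
          {ω | ∃ W ≤ S J, Module.finrank ℝ W = r ∧ ∃ b : Fin m → EuclideanSpace ℝ (Fin n),
            (∀ k, b k ∈ W) ∧ 4 * (σ * noiseLevel (Module.finrank ℝ (S J)) m r
              (logTerm p J.card)) * √(∑ k, ‖b k‖ ^ 2) < pairing (E ω) b} := by
    rintro ω ⟨J, hJ, W, hW, b, hb, hlt⟩
    simp only [Set.mem_iUnion]
    refine ⟨J, by simpa using hJ, Module.finrank ℝ W, ?_, W, hW, rfl, b, hb, hlt⟩
    exact Finset.mem_range.2 (Nat.lt_succ_of_le ((Submodule.finrank_mono hW).trans (hS J)))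
  refine (measureReal_mono hsub (measure_ne_top _ _)).trans ?_
  refine (measureReal_biUnion_finset_le _ _).trans ?_
  refine le_trans (Finset.sum_le_sum fun J _ => ?_) (sum_nonempty_exp_neg_logTerm_le hp)
  refine (measureReal_biUnion_finset_le _ _).trans ?_
  have hJp : J.card ≤ p := by simpa using Finset.card_le_univ J
  refine (Finset.sum_le_card_nsmul _ _ _ fun r _ =>
    measureReal_noiseLevel_lt_pairing_le hE hσ hsg (S J) r (logTerm_nonneg hJp)).trans ?_
  rw [Finset.card_range, nsmul_eq_mul]
  push_cast
  exact le_rfl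

end Noise
-- Row norms and row support
section Rows

variable {p m : ℕ}

theorem rowNorm_eq_norm (B : Matrix (Fin p) (Fin m) ℝ) (j : Fin p) :
    rowNorm B j = ‖(WithLp.toLp 2 (B j) : EuclideanSpace ℝ (Fin m))‖ := by
  simp [rowNorm, EuclideanSpace.norm_eq]

theorem rowNorm_nonneg (B : Matrix (Fin p) (Fin m) ℝ) (j : Fin p) : 0 ≤ rowNorm B j :=
  Real.sqrt_nonneg _

theorem rowNorm_eq_zero_iff {B : Matrix (Fin p) (Fin m) ℝ} {j : Fin p} :
    rowNorm B j = 0 ↔ B j = 0 := by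
  rw [rowNorm_eq_norm, norm_eq_zero, WithLp.toLp_eq_zero]

theorem mem_rowSupport {B : Matrix (Fin p) (Fin m) ℝ} {j : Fin p} :
    j ∈ rowSupport B ↔ rowNorm B j ≠ 0 := by
  simp [rowSupport]

theorem rowNorm_sub_comm (B B' : Matrix (Fin p) (Fin m) ℝ) (j : Fin p) :
    rowNorm (B - B') j = rowNorm (B' - B) j := by
  simp only [rowNorm, Matrix.sub_apply]
  congr 1
  exact Finset.sum_congr rfl fun k _ => by ring

theorem rowNorm_le_add (B B' : Matrix (Fin p) (Fin m) ℝ) (j : Fin p) :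
    rowNorm B j ≤ rowNorm B' j + rowNorm (B - B') j := by
  simp only [rowNorm_eq_norm]
  refine le_trans (le_of_eq ?_) (norm_add_le _ _)
  congr 1
  ext k
  simp

theorem rowNorm_le_norm2Inf (B : Matrix (Fin p) (Fin m) ℝ) (j : Fin p) :
    rowNorm B j ≤ norm2Inf B :=
  le_ciSup (f := fun j => rowNorm B j) (Set.finite_range _).bddAbove j

theorem norm2Inf_nonneg (B : Matrix (Fin p) (Fin m) ℝ) : 0 ≤ norm2Inf B :=
  Real.iSup_nonneg (rowNorm_nonneg B)

theorem card_rowSupport_le (B : Matrix (Fin p) (Fin m) ℝ) : (rowSupport B).card ≤ p := by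
  simpa using Finset.card_le_univ (rowSupport B)

theorem rowSupport_nonempty {B : Matrix (Fin p) (Fin m) ℝ} (hB : B ≠ 0) :
    (rowSupport B).Nonempty := by
  by_contra h
  refine hB (funext fun j => ?_)
  rw [Finset.not_nonempty_iff_eq_empty] at h
  by_contra hj
  have : j ∈ rowSupport B := mem_rowSupport.2 fun h0 => hj (rowNorm_eq_zero_iff.1 h0)
  simp [h] at this

end Rows

/-! ### Column spaces and the Frobenius norm -/

section Columns

variable {n p m : ℕ}

/-- The column space, in Euclidean space. -/
def colSpace (M : Matrix (Fin n) (Fin m) ℝ) : Submodule ℝ (EuclideanSpace ℝ (Fin n)) :=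
  Submodule.span ℝ (Set.range (colVec M))

theorem finrank_colSpace (M : Matrix (Fin n) (Fin m) ℝ) :
    Module.finrank ℝ (colSpace M) = M.rank := by
  let e := (WithLp.linearEquiv 2 ℝ (Fin n → ℝ)).symm
  have h : colSpace M = (Submodule.span ℝ (Set.range M.col)).map (e : _ →ₗ[ℝ] _) := by
    rw [Submodule.map_span, ← Set.range_comp]
    rfl
  rw [h, LinearEquiv.finrank_map_eq, Matrix.rank_eq_finrank_span_cols]

theorem rank_pos_of_ne_zero {B : Matrix (Fin n) (Fin m) ℝ} (hB : B ≠ 0) : 1 ≤ B.rank := by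
  rw [← finrank_colSpace, Nat.one_le_iff_ne_zero]
  intro h
  refine hB ?_
  have h0 := Submodule.finrank_eq_zero.1 h
  ext i k
  have hk : colVec B k ∈ colSpace B := Submodule.subset_span ⟨k, rfl⟩
  rw [h0, Submodule.mem_bot] at hk
  exact congrArg (fun v : EuclideanSpace ℝ (Fin n) => v i) hk

/-- The span of the columns of `X` indexed by `J`. -/
def supportSpace (X : Matrix (Fin n) (Fin p) ℝ) (J : Finset (Fin p)) :
    Submodule ℝ (EuclideanSpace ℝ (Fin n)) :=
  Submodule.span ℝ (J.image (colVec X) : Finset (EuclideanSpace ℝ (Fin n)))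

theorem finrank_supportSpace_le_card (X : Matrix (Fin n) (Fin p) ℝ) (J : Finset (Fin p)) :
    Module.finrank ℝ (supportSpace X J) ≤ J.card :=
  (finrank_span_finset_le_card _).trans Finset.card_image_le

theorem finrank_supportSpace_le_rank (X : Matrix (Fin n) (Fin p) ℝ) (J : Finset (Fin p)) :
    Module.finrank ℝ (supportSpace X J) ≤ X.rank := by
  rw [← finrank_colSpace]
  refine Submodule.finrank_mono (Submodule.span_mono ?_)
  simp only [Finset.coe_image]
  exact Set.image_subset_range _ _

theorem colVec_mul (X : Matrix (Fin n) (Fin p) ℝ) (B : Matrix (Fin p) (Fin m) ℝ) (k : Fin m) :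
    colVec (X * B) k = ∑ j, B j k • colVec X j := by
  ext i
  simp [colVec, Matrix.mul_apply, mul_comm]

theorem colSpace_mul_le (X : Matrix (Fin n) (Fin p) ℝ) (B : Matrix (Fin p) (Fin m) ℝ) :
    colSpace (X * B) ≤ supportSpace X (rowSupport B) := by
  refine Submodule.span_le.2 ?_
  rintro _ ⟨k, rfl⟩
  rw [colVec_mul]
  refine Submodule.sum_mem _ fun j _ => ?_
  by_cases hj : j ∈ rowSupport B
  · exact Submodule.smul_mem _ _ (Submodule.subset_span (by
      simpa using ⟨j, hj, rfl⟩))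
  · have h0 : B j = 0 := rowNorm_eq_zero_iff.1 (by simpa [mem_rowSupport] using hj)
    simp [h0]

theorem frobSq_eq (M : Matrix (Fin n) (Fin m) ℝ) : frobSq M = ∑ k, ‖colVec M k‖ ^ 2 := by
  rw [frobSq, Finset.sum_comm]
  simp [EuclideanSpace.norm_sq_eq, colVec]

theorem frobSq_sub (M N : Matrix (Fin n) (Fin m) ℝ) :
    frobSq (M - N) = frobSq M - 2 * pairing M (colVec N) + frobSq N := by
  rw [frobSq_eq, frobSq_eq, frobSq_eq, pairing, Finset.mul_sum, ← Finset.sum_sub_distrib,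
    ← Finset.sum_add_distrib]
  refine Finset.sum_congr rfl fun k _ => ?_
  rw [← norm_sub_sq_real]
  rfl

theorem pairing_add (M : Matrix (Fin n) (Fin m) ℝ) (a b : Fin m → EuclideanSpace ℝ (Fin n)) :
    pairing M (fun k => a k + b k) = pairing M a + pairing M b := by
  simp [pairing, inner_add_right, Finset.sum_add_distrib]

end Columns

/-! ### Comparing the complexity with the net entropy and with the rate -/

section Complexity

variable {n p m : ℕ}

/-- If R ≤ a, then R ≤ (a + m)/2, so a + m - R is at least half of a + m. If R > a, which happens
when rank X < rank B, then (R - a)(m - R) ≥ 0 gives (a + m - R) R ≥ am, and r ≤ a ≤ m bounds the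
left side by 2am. -/
theorem add_mul_le_two_mul_degrees {s r a R m : ℝ} (hr : 0 ≤ r) (hrs : r ≤ s) (hsa : s ≤ a)
    (hrR : r ≤ R) (hRm : R ≤ m) : (s + m) * r ≤ 2 * ((a + m - R) * R) := by
  rcases le_total R a with h | h
  · have h1 : (s + m) * r ≤ (a + m) * R :=
      mul_le_mul (by linarith) hrR hr (by linarith)
    nlinarith [mul_nonneg (hr.trans hrR) (show 0 ≤ a + m - 2 * R by linarith)]
  · have h1 : (s + m) * r ≤ (a + m) * a :=
      mul_le_mul (by linarith) (by linarith) hr (by linarith)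
    nlinarith [mul_nonneg (sub_nonneg.2 h) (sub_nonneg.2 hRm),
      mul_nonneg (hr.trans (hrs.trans hsa)) (show 0 ≤ m - a by linarith)]

theorem complexity_eq (X : Matrix (Fin n) (Fin p) ℝ) (B : Matrix (Fin p) (Fin m) ℝ) :
    complexity X B = (min (X.rank : ℝ) ((rowSupport B).card : ℝ) + (m : ℝ) - (B.rank : ℝ)) *
      (B.rank : ℝ) + logTerm p (rowSupport B).card := rfl

theorem add_logTerm_le_complexity (X : Matrix (Fin n) (Fin p) ℝ) (B : Matrix (Fin p) (Fin m) ℝ)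
    {s r : ℕ} (hrs : r ≤ s) (hsX : s ≤ X.rank) (hsJ : s ≤ (rowSupport B).card)
    (hrB : r ≤ B.rank) :
    ((s : ℝ) + m) * r + logTerm p (rowSupport B).card ≤ 2 * complexity X B := by
  have h1 := add_mul_le_two_mul_degrees (s := s) (r := r)
    (a := min (X.rank : ℝ) ((rowSupport B).card : ℝ)) (R := B.rank) (m := m)
    (Nat.cast_nonneg r) (by exact_mod_cast hrs)
    (le_min (by exact_mod_cast hsX) (by exact_mod_cast hsJ)) (by exact_mod_cast hrB)
    (by exact_mod_cast B.rank_le_width)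
  have h2 := logTerm_nonneg (card_rowSupport_le B)
  rw [complexity_eq]
  linarith

theorem complexity_nonneg (X : Matrix (Fin n) (Fin p) ℝ) (B : Matrix (Fin p) (Fin m) ℝ) :
    0 ≤ complexity X B := by
  have h := add_logTerm_le_complexity X B (s := 0) (r := 0) le_rfl (Nat.zero_le _)
    (Nat.zero_le _) (Nat.zero_le _)
  have h2 := logTerm_nonneg (card_rowSupport_le B)
  simp at h
  linarith

theorem natCast_mul_one_sub_log_le_one {J : ℕ} (hJ : 1 ≤ J) : (J : ℝ) * (1 - Real.log J) ≤ 1 := by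
  have hJ0 : (0 : ℝ) < J := by exact_mod_cast hJ
  have h := Real.one_sub_inv_le_log_of_pos hJ0
  have h2 : (J : ℝ) * (J : ℝ)⁻¹ = 1 := mul_inv_cancel₀ hJ0.ne'
  nlinarith

theorem complexity_le (X : Matrix (Fin n) (Fin p) ℝ) {B : Matrix (Fin p) (Fin m) ℝ} (hB : B ≠ 0) :
    complexity X B ≤ ((rowSupport B).card : ℝ) * (B.rank + Real.log p) + m * B.rank := by
  have hJ : 1 ≤ (rowSupport B).card := (rowSupport_nonempty hB).card_pos
  have hr : (1 : ℝ) ≤ B.rank := by exact_mod_cast rank_pos_of_ne_zero hB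
  rw [complexity_eq, logTerm_eq hJ (card_rowSupport_le B)]
  have h1 := natCast_mul_one_sub_log_le_one hJ
  have h2 := mul_le_mul_of_nonneg_right
    (min_le_right (X.rank : ℝ) ((rowSupport B).card : ℝ)) (zero_le_one.trans hr)
  -- The surplus J(1 - log J) ≤ 1 is paid for by the term -r², since r ≥ 1.
  nlinarith

theorem complexity_div_le_rowwiseRate (X : Matrix (Fin n) (Fin p) ℝ)
    {B : Matrix (Fin p) (Fin m) ℝ} (hB : B ≠ 0) (hn : 0 < n) {κ : ℝ} (hκ : 0 < κ) :
    complexity X B / (κ * n * (rowSupport B).card) ≤ rowwiseRate n κ B := by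
  have hJ : (0 : ℝ) < (rowSupport B).card := by exact_mod_cast (rowSupport_nonempty hB).card_pos
  have hn' : (0 : ℝ) < n := by exact_mod_cast hn
  have h : rowwiseRate n κ B = (((rowSupport B).card : ℝ) * (B.rank + Real.log p) + m * B.rank) /
      (κ * n * (rowSupport B).card) := by
    rw [rowwiseRate]
    field_simp
  rw [h]
  gcongr
  exact complexity_le X hB

theorem rowwiseRate_pos {B : Matrix (Fin p) (Fin m) ℝ} (hB : B ≠ 0) (hn : 0 < n) {κ : ℝ}
    (hκ : 0 < κ) : 0 < rowwiseRate n κ B := by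
  have hn' : (0 : ℝ) < n := by exact_mod_cast hn
  have hr : (0 : ℝ) < B.rank := by exact_mod_cast rank_pos_of_ne_zero hB
  have hl := Real.log_natCast_nonneg p
  unfold rowwiseRate
  positivity

end Complexity

/-! ### Noise absorption and the oracle inequality -/

section Oracle

variable {n p m : ℕ}

/-- The column space of `X J`, projected orthogonally to `W`. -/
noncomputable def residualSpace (W : Submodule ℝ (EuclideanSpace ℝ (Fin n)))
    (X : Matrix (Fin n) (Fin p) ℝ) (J : Finset (Fin p)) :
    Submodule ℝ (EuclideanSpace ℝ (Fin n)) :=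
  (supportSpace X J).map (Wᗮ.starProjection : _ →ₗ[ℝ] _)

theorem finrank_residualSpace_le (W : Submodule ℝ (EuclideanSpace ℝ (Fin n)))
    (X : Matrix (Fin n) (Fin p) ℝ) (J : Finset (Fin p)) :
    Module.finrank ℝ (residualSpace W X J) ≤ Module.finrank ℝ (supportSpace X J) :=
  Submodule.finrank_map_le _ _

theorem pairing_le_of_noiseLevel {s r : ℕ} {t σ K : ℝ} {M : Matrix (Fin n) (Fin m) ℝ}
    {b : Fin m → EuclideanSpace ℝ (Fin n)} (ht : 0 ≤ t)
    (h : pairing M b ≤ 4 * (σ * noiseLevel s m r t) * √(∑ k, ‖b k‖ ^ 2))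
    (hK : ((s : ℝ) + m) * r + t ≤ 2 * K) :
    pairing M b ≤ (∑ k, ‖b k‖ ^ 2) / 4 + 512 * σ ^ 2 * K := by
  have h1 := noiseLevel_sq (s := s) (m := m) (r := r) ht
  have h2 : √(∑ k, ‖b k‖ ^ 2) ^ 2 = ∑ k, ‖b k‖ ^ 2 :=
    Real.sq_sqrt (Finset.sum_nonneg fun _ _ => sq_nonneg _)
  have h3 : (σ * noiseLevel s m r t) ^ 2 ≤ 32 * σ ^ 2 * K := by
    rw [mul_pow, h1]
    nlinarith [mul_le_mul_of_nonneg_left hK (sq_nonneg σ)]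
  -- xy ≤ x²/4 + y² with y = 4σ · `noiseLevel`; then y² ≤ 16 · 32 σ²K, which gives 512.
  nlinarith [sq_nonneg (√(∑ k, ‖b k‖ ^ 2) / 2 - 4 * (σ * noiseLevel s m r t))]

/-- On the event of uniform noise control, the noise part of the basic inequality is absorbed by
the prediction error and the complexities. -/
theorem pairing_colVec_le {X : Matrix (Fin n) (Fin p) ℝ} {Bstar : Matrix (Fin p) (Fin m) ℝ}
    {M : Matrix (Fin n) (Fin m) ℝ} {σ : ℝ}
    (hstar : ∀ W ≤ colSpace (X * Bstar), Module.finrank ℝ W = (X * Bstar).rank →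
      ∀ b : Fin m → EuclideanSpace ℝ (Fin n), (∀ k, b k ∈ W) →
        pairing M b ≤ 4 * (σ * noiseLevel (Module.finrank ℝ (colSpace (X * Bstar))) m
          (X * Bstar).rank (logTerm p (rowSupport Bstar).card)) * √(∑ k, ‖b k‖ ^ 2))
    (hres : ∀ J : Finset (Fin p), J.Nonempty →
      ∀ W ≤ residualSpace (colSpace (X * Bstar)) X J,
      ∀ b : Fin m → EuclideanSpace ℝ (Fin n), (∀ k, b k ∈ W) →
        pairing M b ≤ 4 * (σ * noiseLevel
          (Module.finrank ℝ (residualSpace (colSpace (X * Bstar)) X J)) m (Module.finrank ℝ W)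
          (logTerm p J.card)) * √(∑ k, ‖b k‖ ^ 2))
    (B : Matrix (Fin p) (Fin m) ℝ) :
    pairing M (colVec (X * (B - Bstar))) ≤ frobSq (X * (B - Bstar)) / 4 +
      512 * σ ^ 2 * complexity X Bstar + 512 * σ ^ 2 * complexity X B := by
  set W := colSpace (X * Bstar) with hW
  have hWstar : Module.finrank ℝ W = (X * Bstar).rank := finrank_colSpace _
  set D := colVec (X * (B - Bstar)) with hD
  set a : Fin m → EuclideanSpace ℝ (Fin n) := fun k => W.starProjection (D k)
  set b : Fin m → EuclideanSpace ℝ (Fin n) := fun k => Wᗮ.starProjection (D k)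
  have hab : D = fun k => a k + b k :=
    funext fun k => (Submodule.starProjection_add_starProjection_orthogonal (D k)).symm
  have hnorm : frobSq (X * (B - Bstar)) = ∑ k, ‖a k‖ ^ 2 + ∑ k, ‖b k‖ ^ 2 := by
    rw [frobSq_eq, ← Finset.sum_add_distrib]
    exact Finset.sum_congr rfl fun k _ => Submodule.norm_sq_eq_add_norm_sq_starProjection _ W
  -- Projecting off W removes `X Bstar`, so the rank of b is controlled by B alone and not by B -
  -- Bstar.
  have hb : ∀ k, b k = Wᗮ.starProjection (colVec (X * B) k) := by
    intro k
    have h1 : D k = colVec (X * B) k - colVec (X * Bstar) k := by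
      rw [hD, Matrix.mul_sub]; rfl
    have h2 : colVec (X * Bstar) k ∈ W := Submodule.subset_span ⟨k, rfl⟩
    change Wᗮ.starProjection (D k) = _
    rw [h1, map_sub, Submodule.starProjection_orthogonal_apply_eq_zero h2, sub_zero]
  have ha_le : pairing M a ≤ (∑ k, ‖a k‖ ^ 2) / 4 + 512 * σ ^ 2 * complexity X Bstar := by
    have h1 := Submodule.finrank_mono (colSpace_mul_le X Bstar)
    refine pairing_le_of_noiseLevel (logTerm_nonneg (card_rowSupport_le Bstar))
      (hstar W le_rfl hWstar a fun k => Submodule.starProjection_apply_mem _ _) ?_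
    refine add_logTerm_le_complexity X Bstar hWstar.ge
      (h1.trans (finrank_supportSpace_le_rank _ _))
      (h1.trans (finrank_supportSpace_le_card _ _)) (Matrix.rank_mul_le_right _ _)
  have hb_le : pairing M b ≤ (∑ k, ‖b k‖ ^ 2) / 4 + 512 * σ ^ 2 * complexity X B := by
    by_cases hB : B = 0
    · have h0 : b = fun _ => 0 := by
        funext k
        rw [hb, hB, Matrix.mul_zero]
        exact map_zero _
      have h1 : pairing M b = 0 := by simp [h0, pairing]
      have h2 := complexity_nonneg X B
      rw [h1]
      positivity
    · set V := (colSpace (X * B)).map (Wᗮ.starProjection : _ →ₗ[ℝ] EuclideanSpace ℝ (Fin n))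
      have hV : V ≤ residualSpace W X (rowSupport B) := Submodule.map_mono (colSpace_mul_le X B)
      have hbV : ∀ k, b k ∈ V := fun k => by
        rw [hb]
        exact Submodule.mem_map_of_mem (Submodule.subset_span ⟨k, rfl⟩)
      have h1 := finrank_residualSpace_le W X (rowSupport B)
      refine pairing_le_of_noiseLevel (logTerm_nonneg (card_rowSupport_le B))
        (hres _ (rowSupport_nonempty hB) V hV b hbV) ?_
      refine add_logTerm_le_complexity X B (Submodule.finrank_mono hV)
        (h1.trans (finrank_supportSpace_le_rank _ _))
        (h1.trans (finrank_supportSpace_le_card _ _)) ?_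
      refine (Submodule.finrank_map_le _ _).trans ?_
      rw [finrank_colSpace]
      exact Matrix.rank_mul_le_right _ _
  rw [hnorm, hab, pairing_add]
  linarith

/-- The oracle inequality for a minimizer, with slack in the constant. -/
theorem frobSq_add_penalty_le_of_isPICMinimizer {X : Matrix (Fin n) (Fin p) ℝ}
    {Bstar Bhat : Matrix (Fin p) (Fin m) ℝ} {M Y : Matrix (Fin n) (Fin m) ℝ} {σ A : ℝ}
    (hA : 2048 ≤ A) (hY : Y = X * Bstar + M) (hmin : IsPICMinimizer X Y σ A Bhat)
    (hnoise : pairing M (colVec (X * (Bhat - Bstar))) ≤ frobSq (X * (Bhat - Bstar)) / 4 +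
      512 * σ ^ 2 * complexity X Bstar + 512 * σ ^ 2 * complexity X Bhat) :
    frobSq (X * Bhat - X * Bstar) / 2 + penalty X σ A Bhat + penalty X σ A Bstar ≤
      7 / 2 * penalty X σ A Bstar := by
  have h := hmin Bstar
  have h1 : Y - X * Bstar = M := by rw [hY]; abel
  have h2 : Y - X * Bhat = M - X * (Bhat - Bstar) := by rw [hY, Matrix.mul_sub]; abel
  rw [criterion, criterion, h1, h2, frobSq_sub] at h
  rw [← Matrix.mul_sub]
  -- This fixes the constant 2048 = 4 · 512.
  have h3 : ∀ B : Matrix (Fin p) (Fin m) ℝ,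
      512 * σ ^ 2 * complexity X B ≤ penalty X σ A B / 4 := fun B => by
    have := mul_le_mul_of_nonneg_right hA (mul_nonneg (sq_nonneg σ) (complexity_nonneg X B))
    rw [penalty]
    linarith
  have h4 := h3 Bstar
  have h5 := h3 Bhat
  have h6 : 0 ≤ penalty X σ A Bhat := by
    have := complexity_nonneg X Bhat
    unfold penalty
    positivity
  -- Doubling the basic inequality after absorption gives ½‖XΔ‖² + 3/2 · P(Bhat) ≤ 5/2 · P(Bstar);
  -- adding P(Bstar) yields 7/2.
  linarith

end Oracle

/-! ### Separation of rows and the main theorem -/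

/-- Separation of the row norms from a row-wise error bound. -/
theorem rowSupport_subset_and_rowNorm_lt {p m : ℕ} {B B' : Matrix (Fin p) (Fin m) ℝ}
    (h : ∀ j ∈ rowSupport B, 2 * norm2Inf (B' - B) < rowNorm B j) :
    rowSupport B ⊆ rowSupport B' ∧
      ∀ j ∈ rowSupport B, ∀ j' ∉ rowSupport B, rowNorm B' j' < rowNorm B' j := by
  have hlow : ∀ j ∈ rowSupport B, norm2Inf (B' - B) < rowNorm B' j := by
    intro j hj
    have h1 := rowNorm_le_add B B' j
    rw [rowNorm_sub_comm] at h1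
    have h2 := rowNorm_le_norm2Inf (B' - B) j
    have h3 := h j hj
    linarith
  refine ⟨fun j hj => mem_rowSupport.2 ?_, fun j hj j' hj' => ?_⟩
  · exact ((norm2Inf_nonneg _).trans_lt (hlow j hj)).ne'
  · have h1 : rowNorm B j' = 0 := by simpa [mem_rowSupport] using hj'
    have h2 := rowNorm_le_add B' B j'
    rw [h1, zero_add] at h2
    exact (h2.trans (rowNorm_le_norm2Inf _ _)).trans_lt (hlow j hj)

end PIC

open PIC in
theorem theorem5 :
    ∃ A₀ > (0 : ℝ), ∃ C > (0 : ℝ), ∃ c > (0 : ℝ),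
      ∀ (n p m : ℕ) (Ω : Type*) [MeasurableSpace Ω] (P : Measure Ω) [IsProbabilityMeasure P]
        (X : Matrix (Fin n) (Fin p) ℝ) (Bstar : Matrix (Fin p) (Fin m) ℝ)
        (E Y : Ω → Matrix (Fin n) (Fin m) ℝ) (σ A κ : ℝ),
        0 < n → Bstar ≠ 0 → 0 ≤ σ → A₀ ≤ A → 0 < κ →
        (∀ ω, Y ω = X * Bstar + E ω) →
        (∀ i k, Measurable fun ω => E ω i k) →
        (∀ i k, ∫ ω, E ω i k ∂P = 0) →
        PIC.IsSubGaussianVector P (fun ω => (E ω).vec) σ →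
        (∀ B : Matrix (Fin p) (Fin m) ℝ,
          κ * (n : ℝ) * ((PIC.rowSupport Bstar).card : ℝ) * PIC.norm2Inf (B - Bstar) ^ 2 / 2 ≤
            PIC.frobSq (X * B - X * Bstar) / 2 + PIC.penalty X σ A B + PIC.penalty X σ A Bstar) →
        8 * A * σ ^ 2 *
              (PIC.complexity X Bstar / (κ * (n : ℝ) * ((PIC.rowSupport Bstar).card : ℝ))) ≤
            8 * A * σ ^ 2 * PIC.rowwiseRate n κ Bstar ∧
          ∃ S : Set Ω, MeasurableSet S ∧ 1 - C * (p : ℝ) ^ (-c) ≤ P.real S ∧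
            ∀ ω ∈ S, ∀ Bhat : Matrix (Fin p) (Fin m) ℝ, PIC.IsPICMinimizer X (Y ω) σ A Bhat →
              PIC.norm2Inf (Bhat - Bstar) ^ 2 ≤
                  8 * A * σ ^ 2 *
                    (PIC.complexity X Bstar /
                      (κ * (n : ℝ) * ((PIC.rowSupport Bstar).card : ℝ))) ∧
                ((∀ j ∈ PIC.rowSupport Bstar,
                    4 * √(2 * A) * σ * √(PIC.rowwiseRate n κ Bstar) ≤ PIC.rowNorm Bstar j) →
                  PIC.rowSupport Bstar ⊆ PIC.rowSupport Bhat ∧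
                    ∀ j ∈ PIC.rowSupport Bstar, ∀ j' ∉ PIC.rowSupport Bstar,
                      PIC.rowNorm Bhat j' < PIC.rowNorm Bhat j) := by
  refine ⟨2048, by norm_num, 4, by norm_num, 1, one_pos, ?_⟩
  intro n p m Ω _ P _ X Bstar E Y σ A κ hn hB hσ hA hκ hY hE _ hsg hκB
  have hA0 : 0 ≤ A := by linarith
  have hn' : (0 : ℝ) < n := by exact_mod_cast hn
  have hJ1 : 1 ≤ (rowSupport Bstar).card := (rowSupport_nonempty hB).card_pos
  have hJp := card_rowSupport_le Bstar
  have hJ : (0 : ℝ) < (rowSupport Bstar).card := by exact_mod_cast hJ1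
  have hp : 0 < p := by omega
  have hrate := complexity_div_le_rowwiseRate X hB hn hκ
  have hrate0 := rowwiseRate_pos hB hn hκ
  refine ⟨mul_le_mul_of_nonneg_left hrate (by positivity), ?_⟩
  set W := colSpace (X * Bstar) with hW
  set bad₁ : Set Ω := {ω | ∃ V ≤ W, Module.finrank ℝ V = (X * Bstar).rank ∧
    ∃ b : Fin m → EuclideanSpace ℝ (Fin n), (∀ k, b k ∈ V) ∧
      4 * (σ * noiseLevel (Module.finrank ℝ W) m (X * Bstar).rank
        (logTerm p (rowSupport Bstar).card)) * √(∑ k, ‖b k‖ ^ 2) < pairing (E ω) b} with hbad₁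
  set bad₂ : Set Ω := {ω | ∃ J : Finset (Fin p), J.Nonempty ∧ ∃ V ≤ residualSpace W X J,
    ∃ b : Fin m → EuclideanSpace ℝ (Fin n), (∀ k, b k ∈ V) ∧
      4 * (σ * noiseLevel (Module.finrank ℝ (residualSpace W X J)) m (Module.finrank ℝ V)
        (logTerm p J.card)) * √(∑ k, ‖b k‖ ^ 2) < pairing (E ω) b} with hbad₂
  have h₁ : P.real bad₁ ≤ 2 / p :=
    (measureReal_noiseLevel_lt_pairing_le hE hσ hsg W _ (logTerm_nonneg hJp)).trans
      (two_mul_exp_neg_logTerm_le hJ1 hJp)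
  have h₂ : P.real bad₂ ≤ 2 / p :=
    measureReal_exists_support_pairing_le hE hσ hsg hp (residualSpace W X) fun J =>
      (finrank_residualSpace_le W X J).trans (finrank_supportSpace_le_card X J)
  -- The bad sets are not shown to be measurable, so a measurable hull of equal probability is
  -- removed.
  refine ⟨(toMeasurable P (bad₁ ∪ bad₂))ᶜ, (measurableSet_toMeasurable _ _).compl, ?_, ?_⟩
  · rw [probReal_compl_eq_one_sub (measurableSet_toMeasurable _ _), Real.rpow_neg_one]
    have h3 : P.real (toMeasurable P (bad₁ ∪ bad₂)) = P.real (bad₁ ∪ bad₂) := by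
      rw [Measure.real, measure_toMeasurable, Measure.real]
    have h4 := measureReal_union_le (μ := P) bad₁ bad₂
    rw [h3]
    have h5 : (2 : ℝ) / p + 2 / p = 4 * (p : ℝ)⁻¹ := by ring
    linarith
  intro ω hω Bhat hmin
  have hω' : ω ∉ bad₁ ∪ bad₂ := fun h => hω (subset_toMeasurable _ _ h)
  rw [Set.mem_union, not_or] at hω'
  obtain ⟨hω₁, hω₂⟩ := hω'
  have hnoise : pairing (E ω) (colVec (X * (Bhat - Bstar))) ≤ frobSq (X * (Bhat - Bstar)) / 4 +
      512 * σ ^ 2 * complexity X Bstar + 512 * σ ^ 2 * complexity X Bhat := by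
    refine pairing_colVec_le ?_ ?_ Bhat
    · intro V hV hr b hb
      by_contra hlt
      exact hω₁ ⟨V, hV, hr, b, hb, not_le.1 hlt⟩
    · intro J hJ V hV b hb
      by_contra hlt
      exact hω₂ ⟨J, hJ, V, hV, b, hb, not_le.1 hlt⟩
  have horacle := (hκB Bhat).trans
    (frobSq_add_penalty_le_of_isPICMinimizer hA (hY ω) hmin hnoise)
  have hden : 0 < κ * n * (rowSupport Bstar).card := by positivity
  set N := norm2Inf (Bhat - Bstar) with hN
  have hN0 : 0 ≤ N := norm2Inf_nonneg _
  -- The constant is 7 instead of 8; the gap later makes the separation of rows strict.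
  have hNsq : N ^ 2 ≤ 7 * (A * σ ^ 2) *
      (complexity X Bstar / (κ * n * (rowSupport Bstar).card)) := by
    rw [← mul_div_assoc, le_div_iff₀ hden]
    rw [penalty] at horacle
    linarith
  have hAσ : 0 ≤ A * σ ^ 2 := by positivity
  have hc0 : 0 ≤ complexity X Bstar / (κ * n * (rowSupport Bstar).card) :=
    div_nonneg (complexity_nonneg X Bstar) hden.le
  refine ⟨by nlinarith [mul_nonneg hAσ hc0], fun hbeta => ?_⟩
  refine rowSupport_subset_and_rowNorm_lt fun j hj => ?_
  rw [← hN]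
  -- For σ = 0 the threshold vanishes and gives no strictness, but then the error is 0 and rows in
  -- the support are nonzero.
  rcases hσ.eq_or_lt with h0 | hσ0
  · rw [← h0] at hNsq
    have hN1 : N = 0 := by
      have : N ^ 2 ≤ 0 := by simpa using hNsq
      exact pow_eq_zero_iff two_ne_zero |>.1 (le_antisymm this (sq_nonneg N))
    rw [hN1, mul_zero]
    exact lt_of_le_of_ne (rowNorm_nonneg _ _) (Ne.symm (mem_rowSupport.1 hj))
  · refine lt_of_lt_of_le ?_ (hbeta j hj)
    refine lt_of_pow_lt_pow_left₀ 2 (by positivity) ?_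
    have hpos : 0 < A * σ ^ 2 := by
      have : 0 < A := by linarith
      positivity
    have h4 : (4 * √(2 * A) * σ * √(rowwiseRate n κ Bstar)) ^ 2 =
        32 * (A * σ ^ 2) * rowwiseRate n κ Bstar := by
      rw [mul_pow, mul_pow, mul_pow, Real.sq_sqrt (by positivity), Real.sq_sqrt hrate0.le]
      ring
    rw [h4]
    -- (2N)² ≤ 28 Aσ² · rate < 32 Aσ² · rate, the last being the squared threshold.
    nlinarith [mul_le_mul_of_nonneg_left hrate hpos.le, mul_pos hpos hrate0]
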